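/- Let $\mathcal X,\mathcal Y$ be non-empty sets, let $\mathcal F$ be a $\sigma$-algebra on $\mathcal Y$, and let $f:\mathcal X\to[0,+\infty)$ and $g:\mathcal X\times\mathcal Y\to[0,+\infty)$ be functions such that $g(x,\cdot)$ is $\mathcal F$-measurable for every $x\in\mathcal X$. For $n\in\mathbb N=\{1,2,\dots\}$ and $\mathbf x=(x_1,\dots,x_n)\in\mathcal X^n$ write $f^{\otimes n}(\mathbf x)=\prod_{j=1}^n f(x_j)$ and $g_y^{\otimes n}(\mathbf x)=\prod_{j=1}^n g(x_j,y)$. We use $\log 0=-\infty$, $\log(+\infty)=+\infty$, $e^{-\infty}=0$; the integral of a measurable $[-\infty,+\infty]$-valued function is said to exist if the integral of its positive part or that of its negative part is finite, and it is then the difference of the two. Consider the following statements. (i) There is a probability measure $\nu$ on $\mathcal F$ such that, for every $x\in\mathcal X$, the integral $\int_{\mathcal Y}\log g(x,y)\,d\nu(y)$ exists in $[-\infty,+\infty)$ and $$f(x)\le\exp\left(\int_{\mathcal Y}\log g(x,y)\,d\nu(y)\right).$$ (ii) There is a sequence $(\nu_n)_{n\in\mathbb N}$ of probability measures on $\mathcal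 F$ such that, for every $n\in\mathbb N$ and every $\mathbf x\in\mathcal X^n$, the integral $\int_{\mathcal Y}\log g_y^{\otimes n}(\mathbf x)\,d\nu_n(y)$ exists in $[-\infty,+\infty)$ and $$f^{\otimes n}(\mathbf x)\le\exp\left(\int_{\mathcal Y}\log g_y^{\otimes n}(\mathbf x)\,d\nu_n(y)\right).$$ (iii) There is a probability measure $\mu$ on $\mathcal F$ such that, for every $n\in\mathbb N$ and every $\mathbf x\in\mathcal X^n$, $$f^{\otimes n}(\mathbf x)\le\int_{\mathcal Y}g_y^{\otimes n}(\mathbf x)\,d\mu(y).$$ (iv) There is a sequence $(\mu_n)_{n\in\mathbb N}$ of positive measures on $\mathcal F$ such that $$\limsup_{n\to+\infty}\frac1n\log\mu_n(\mathcal Y)\le 0$$ and, for every $n\in\mathbb N$ and every $\mathbf x\in\mathcal X^n$, $$f^{\otimes n}(\mathbf x)\le\int_{\mathcal Y}g_y^{\otimes n}(\mathbf x)\,d\mu_n(y).$$ (The integrals in (iii) and (iv) take values in $[0,+\infty]$.) Then (i)$\iff$(ii)$\implies$(iii)$\implies$(iv). Moreover, if $\mathcal Y$ is a compact Hausdorff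 topological space, $\mathcal F$ is its Borel $\sigma$-algebra, and $g(x,\cdot)$ is continuous on $\mathcal Y$ for every $x\in\mathcal X$, then also (iv)$\implies$(i). -/

import Mathlib

open MeasureTheory Filter Topology
open scoped NNReal ENNReal

namespace MeanBounds

/-- The integral of an extended-real-valued (measurable) function exists in `[-∞, +∞]`: at least
one of the integrals of its positive and negative parts is finite. -/
def IntegralExists {Y : Type*} [MeasurableSpace Y] (ν : Measure Y) (φ : Y → EReal) : Prop :=
  ∫⁻ y, (φ y).toENNReal ∂ν ≠ ⊤ ∨ ∫⁻ y, (-φ y).toENNReal ∂ν ≠ ⊤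

/-- The extended-real value of the integral, the integral of the positive part minus that of the
negative part. It is meaningful when `IntegralExists ν φ` holds. -/
noncomputable def extIntegral {Y : Type*} [MeasurableSpace Y] (ν : Measure Y) (φ : Y → EReal) :
    EReal :=
  ((∫⁻ y, (φ y).toENNReal ∂ν : ℝ≥0∞) : EReal) - ((∫⁻ y, (-φ y).toENNReal ∂ν : ℝ≥0∞) : EReal)

/-- The `n`-th tensor power of a function. -/
def tensorPow {X : Type*} (f : X → ℝ≥0) (n : ℕ) (x : Fin n → X) : ℝ≥0 :=
  ∏ j, f (x j)

/-- `log a` for `a ∈ [0, ∞)`, as an extended real number, with `log 0 = -∞`. -/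
noncomputable def elog (a : ℝ≥0) : EReal := ENNReal.log (a : ℝ≥0∞)

/-- Single-copy upper bound by a weighted geometric mean. -/
def SingleCopyGeometric {X Y : Type*} [MeasurableSpace Y] (f : X → ℝ≥0) (g : X → Y → ℝ≥0) : Prop :=
  ∃ ν : Measure Y, IsProbabilityMeasure ν ∧
    (∀ x : X, IntegralExists ν (fun y => elog (g x y)) ∧
      extIntegral ν (fun y => elog (g x y)) < ⊤) ∧
    ∀ x : X, (f x : ℝ≥0∞) ≤ EReal.exp (extIntegral ν (fun y => elog (g x y)))

/-- Multi-copy upper bounds by a sequence of weighted geometric means (indices `n ≥ 1`). -/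
def MultiCopyGeometric {X Y : Type*} [MeasurableSpace Y] (f : X → ℝ≥0) (g : X → Y → ℝ≥0) : Prop :=
  ∃ ν : ℕ → Measure Y, (∀ n, 1 ≤ n → IsProbabilityMeasure (ν n)) ∧
    (∀ n, 1 ≤ n → ∀ x : Fin n → X,
      IntegralExists (ν n) (fun y => elog (tensorPow (fun z => g z y) n x)) ∧
      extIntegral (ν n) (fun y => elog (tensorPow (fun z => g z y) n x)) < ⊤) ∧
    ∀ n, 1 ≤ n → ∀ x : Fin n → X, (tensorPow f n x : ℝ≥0∞) ≤
      EReal.exp (extIntegral (ν n) (fun y => elog (tensorPow (fun z => g z y) n x)))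

/-- Multi-copy upper bounds by a weighted arithmetic mean, with one measure for all `n ≥ 1`. -/
def MultiCopyArithmetic {X Y : Type*} [MeasurableSpace Y] (f : X → ℝ≥0) (g : X → Y → ℝ≥0) : Prop :=
  ∃ μ : Measure Y, IsProbabilityMeasure μ ∧
    ∀ n, 1 ≤ n → ∀ x : Fin n → X,
      (tensorPow f n x : ℝ≥0∞) ≤ ∫⁻ y, (tensorPow (fun z => g z y) n x : ℝ≥0∞) ∂μ

/-- Multi-copy upper bounds by a sequence of weighted arithmetic means (indices `n ≥ 1`), the
total masses of the positive measures growing at most subexponentially. -/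
def MultiCopyArithmeticSeq {X Y : Type*} [MeasurableSpace Y] (f : X → ℝ≥0) (g : X → Y → ℝ≥0) :
    Prop :=
  ∃ μ : ℕ → Measure Y,
    limsup (fun n : ℕ => ENNReal.log (μ n Set.univ) / (n : EReal)) atTop ≤ 0 ∧
    ∀ n, 1 ≤ n → ∀ x : Fin n → X,
      (tensorPow f n x : ℝ≥0∞) ≤ ∫⁻ y, (tensorPow (fun z => g z y) n x : ℝ≥0∞) ∂(μ n)

end MeanBounds

namespace MeanBounds

/-! ### Positive functionals and measures on a compact space -/

/-! Integrated logarithms add up over tensor factors, so one `ν` serves all `n`, and Jensen's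
inequality then bounds the geometric mean by the arithmetic one. The compact case is a separation
argument. Let `S` be the functions `log max(g x, e^{-k}) - log (f x)` with `f x ≠ 0`. If a finite
sum from `S` were at most `-1` everywhere, some list of `n` points would satisfy `∏ g ≤ e⁻¹ ∏ f` on
`Y`; repeating the list `k` times forces `μ (k * n)` to have mass at least `e^k`, against
subexponential growth. Hence the cone over `S` misses the strictly negative functions. Hahn-Banach
(`exists_positive_functional_nonneg`) and Riesz-Markov give `ν`, and monotone convergence in `k`
(`le_exp_extIntegral_elog`) removes the truncation. -/

/-- Passes from real cone coefficients to honest finite sums: rounding `N * c` down costs at most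
`‖x‖`, whatever `N` is. -/
theorem exists_mem_closure_norm_sub_nsmul_le {E : Type*} [NormedAddCommGroup E] [NormedSpace ℝ E]
    {S : Set E} {h : E} (hh : h ∈ Submodule.span ℝ≥0 S) :
    ∃ C : ℝ, ∀ N : ℕ, ∃ a ∈ AddSubmonoid.closure S, ‖a - (N : ℝ) • h‖ ≤ C := by
  induction hh using Submodule.span_induction with
  | mem x hx =>
    refine ⟨0, fun N => ⟨N • x, nsmul_mem (AddSubmonoid.subset_closure hx) N, ?_⟩⟩
    simp [Nat.cast_smul_eq_nsmul]
  | zero => exact ⟨0, fun N => ⟨0, zero_mem _, by simp⟩⟩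
  | add x y _ _ hx hy =>
    obtain ⟨C, hC⟩ := hx
    obtain ⟨D, hD⟩ := hy
    refine ⟨C + D, fun N => ?_⟩
    obtain ⟨a, ha, ha'⟩ := hC N
    obtain ⟨b, hb, hb'⟩ := hD N
    refine ⟨a + b, add_mem ha hb, ?_⟩
    calc ‖a + b - (N : ℝ) • (x + y)‖ = ‖(a - (N : ℝ) • x) + (b - (N : ℝ) • y)‖ := by
          congr 1; module
      _ ≤ C + D := (norm_add_le _ _).trans (add_le_add ha' hb')
  | smul c x _ hx =>
    obtain ⟨C, hC⟩ := hx
    refine ⟨C + ‖x‖, fun N => ?_⟩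
    obtain ⟨a, ha, ha'⟩ := hC ⌊(N : ℝ) * c⌋₊
    refine ⟨a, ha, ?_⟩
    have h1 := Nat.floor_le (a := (N : ℝ) * c) (by positivity)
    have h2 := Nat.lt_floor_add_one ((N : ℝ) * c)
    calc ‖a - (N : ℝ) • c • x‖
        = ‖(a - (⌊(N : ℝ) * c⌋₊ : ℝ) • x) + ((⌊(N : ℝ) * c⌋₊ : ℝ) - N * c) • x‖ := by
          rw [NNReal.smul_def]; congr 1; module
      _ ≤ C + ‖x‖ := by
          refine (norm_add_le _ _).trans (add_le_add ha' ?_)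
          rw [norm_smul]
          refine mul_le_of_le_one_left (norm_nonneg _) ?_
          rw [Real.norm_eq_abs, abs_le]
          constructor <;> linarith

/-- If no finite sum of members of `S` is everywhere at most `-1`, then some positive normalised
functional is nonnegative on `S`. -/
theorem exists_positive_functional_nonneg {Y : Type*} [TopologicalSpace Y] [CompactSpace Y]
    {S : Set C(Y, ℝ)}
    (hS : ∀ h ∈ AddSubmonoid.closure S, ¬ ∀ y, h y ≤ -1) :
    ∃ L : C(Y, ℝ) →L[ℝ] ℝ, (∀ h, 0 ≤ h → 0 ≤ L h) ∧ L 1 = 1 ∧ ∀ h ∈ S, 0 ≤ L h := by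
  have hYne : Nonempty Y := by
    by_contra hY
    rw [not_nonempty_iff] at hY
    exact hS 0 (zero_mem _) fun y => isEmptyElim y
  set U : Set C(Y, ℝ) := {h | ∀ y, h y < 0} with hU
  have hUo : IsOpen U := by
    have := ContinuousMap.isOpen_setOfPred_mapsTo (X := Y) (Y := ℝ) isCompact_univ (isOpen_Iio (a := 0))
    simpa [hU, Set.MapsTo] using this
  have hUc : Convex ℝ U := by
    intro a ha b hb s t hs ht hst y
    have h1 := ha y
    have h2 := hb y
    simp only [ContinuousMap.add_apply, ContinuousMap.smul_apply, smul_eq_mul]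
    rcases hs.eq_or_lt with rfl | hs
    · have : t = 1 := by linarith
      subst this
      simpa using h2
    · nlinarith [mul_neg_of_pos_of_neg hs h1, mul_nonpos_of_nonneg_of_nonpos ht h2.le]
  set K : Set C(Y, ℝ) := (Submodule.span ℝ≥0 S : Set C(Y, ℝ)) with hK
  have hKc : Convex ℝ K := by
    intro a ha b hb s t hs ht _
    exact add_mem (Submodule.smul_mem _ (⟨s, hs⟩ : ℝ≥0) ha)
      (Submodule.smul_mem _ (⟨t, ht⟩ : ℝ≥0) hb)
  have hdisj : Disjoint U K := by
    rw [Set.disjoint_left]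
    intro h hhU hhK
    obtain ⟨C, hC⟩ := exists_mem_closure_norm_sub_nsmul_le hhK
    obtain ⟨y₀, -, hy₀⟩ := isCompact_univ.exists_isMaxOn Set.univ_nonempty h.continuous.continuousOn
    have hneg := hhU y₀
    -- `N • h ≤ -(C + 1)` everywhere, which leaves `-1` after the rounding error `C`.
    obtain ⟨N, hN⟩ := exists_nat_ge ((C + 1) / (-h y₀))
    obtain ⟨a, ha, ha'⟩ := hC N
    refine hS a ha fun y => ?_
    have h1 := (ContinuousMap.norm_coe_le_norm (a - (N : ℝ) • h) y).trans ha'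
    have h2 := (abs_le.1 h1).2
    simp only [ContinuousMap.sub_apply, ContinuousMap.smul_apply, smul_eq_mul] at h2
    have h3 : h y ≤ h y₀ := hy₀ (Set.mem_univ y)
    rw [div_le_iff₀ (by linarith)] at hN
    have h4 : (N : ℝ) * h y ≤ N * h y₀ := by gcongr
    linarith
  obtain ⟨L, u, hLU, hLK⟩ := geometric_hahn_banach_open hUc hUo hKc hdisj
  have hconst : ∀ c : ℝ, 0 < c → (-c) • (1 : C(Y, ℝ)) ∈ U := by
    intro c hc y
    simpa using hc
  have hu : u = 0 := by
    apply le_antisymm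
    · simpa using hLK 0 (zero_mem _)
    · by_contra! hu
      have h1 := hLU _ (hconst 1 one_pos)
      simp only [map_smul, smul_eq_mul] at h1
      have hpos : 0 < L 1 := by linarith
      -- The constant is chosen so that `L` takes the value `u / 2 > u` on a member of `U`.
      have h2 := hLU _ (hconst (-u / (2 * L 1)) (by apply div_pos <;> linarith))
      simp only [map_smul, smul_eq_mul] at h2
      have : -(-u / (2 * L 1)) * L 1 = u / 2 := by field_simp
      linarith
  subst hu
  have hL1 : 0 < L 1 := by
    have h1 := hLU _ (hconst 1 one_pos)
    simp only [map_smul, smul_eq_mul] at h1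
    linarith
  have hLpos : ∀ h : C(Y, ℝ), 0 ≤ h → 0 ≤ L h := by
    intro h hh
    by_contra! hneg
    have h1 : -h + (-(-L h / (2 * L 1))) • (1 : C(Y, ℝ)) ∈ U := by
      intro y
      have h2 : 0 ≤ h y := hh y
      have h3 : 0 < -L h / (2 * L 1) := by apply div_pos <;> linarith
      simp only [ContinuousMap.add_apply, ContinuousMap.neg_apply, ContinuousMap.smul_apply,
        ContinuousMap.one_apply, smul_eq_mul]
      linarith
    have h2 := hLU _ h1
    simp only [map_add, map_neg, map_smul, smul_eq_mul] at h2
    have : -(-L h / (2 * L 1)) * L 1 = L h / 2 := by field_simp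
    linarith
  refine ⟨(L 1)⁻¹ • L, fun h hh => ?_, ?_, fun h hh => ?_⟩
  · exact mul_nonneg (inv_nonneg.2 hL1.le) (hLpos h hh)
  · exact inv_mul_cancel₀ hL1.ne'
  · exact mul_nonneg (inv_nonneg.2 hL1.le) (hLK h (Submodule.subset_span hh))

theorem exists_isProbabilityMeasure_integral_eq {Y : Type*} [TopologicalSpace Y] [CompactSpace Y]
    [T2Space Y] [MeasurableSpace Y] [BorelSpace Y] (L : C(Y, ℝ) →L[ℝ] ℝ)
    (hL : ∀ h, 0 ≤ h → 0 ≤ L h) (hL1 : L 1 = 1) :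
    ∃ ν : Measure Y, IsProbabilityMeasure ν ∧ ∀ h : C(Y, ℝ), ∫ y, h y ∂ν = L h := by
  let Λ : CompactlySupportedContinuousMap Y ℝ →ₚ[ℝ] ℝ := PositiveLinearMap.mk₀
    { toFun := fun h => L h.toContinuousMap
      map_add' := fun a b => L.map_add a.toContinuousMap b.toContinuousMap
      map_smul' := fun c a => L.map_smul c a.toContinuousMap } (fun h hh => hL _ hh)
  have hint : ∀ h : C(Y, ℝ), ∫ y, h y ∂(RealRMK.rieszMeasure Λ) = L h := fun h =>
    RealRMK.integral_rieszMeasure Λ (CompactlySupportedContinuousMap.continuousMapEquiv h)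
  refine ⟨RealRMK.rieszMeasure Λ, ⟨?_⟩, hint⟩
  have h1 := hint 1
  simp only [ContinuousMap.one_apply, integral_const, smul_eq_mul, mul_one, hL1] at h1
  exact (ENNReal.toReal_eq_one_iff _).1 h1

/-! ### Extended logarithmic integrals -/

theorem elog_of_ne_zero {a : ℝ≥0} (ha : a ≠ 0) : elog a = (Real.log a : EReal) :=
  ENNReal.log_of_nnreal ha

theorem elog_zero : elog 0 = ⊥ := by simp [elog]

theorem elog_mul (a b : ℝ≥0) : elog (a * b) = elog a + elog b := by
  simp [elog, ENNReal.log_mul_add]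

/-- The default `Real.log 0 = 0` is harmless for positive parts, but not for negative parts, where
`elog 0 = ⊥` counts. -/
theorem elog_toENNReal (a : ℝ≥0) : (elog a).toENNReal = ENNReal.ofReal (Real.log a) := by
  by_cases ha : a = 0
  · simp [ha, elog_zero]
  · rw [elog_of_ne_zero ha, EReal.real_coe_toENNReal]

theorem neg_elog_toENNReal {a : ℝ≥0} (ha : a ≠ 0) :
    (-elog a).toENNReal = ENNReal.ofReal (-Real.log a) := by
  rw [elog_of_ne_zero ha, ← EReal.coe_neg, EReal.real_coe_toENNReal]

theorem measurable_elog : Measurable elog :=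
  ENNReal.measurable_log.comp measurable_coe_nnreal_ennreal

variable {Y : Type*} [MeasurableSpace Y] {ν : Measure Y}

theorem integralExists_and_extIntegral_lt_top_iff {φ : Y → EReal} :
    (IntegralExists ν φ ∧ extIntegral ν φ < ⊤) ↔ ∫⁻ y, (φ y).toENNReal ∂ν ≠ ⊤ := by
  constructor
  · rintro ⟨h1, h2⟩ h3
    have h4 : ∫⁻ y, (-φ y).toENNReal ∂ν ≠ ⊤ := by
      rcases h1 with h1 | h1
      · exact absurd h3 h1
      · exact h1
    lift ∫⁻ y, (-φ y).toENNReal ∂ν to ℝ≥0 using h4 with b hb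
    rw [extIntegral, h3, ← hb] at h2
    exact absurd h2 (by change ¬ (⊤ - ((b : ℝ) : EReal) < ⊤); simp)
  · intro h
    refine ⟨Or.inl h, ?_⟩
    rw [extIntegral]
    lift ∫⁻ y, (φ y).toENNReal ∂ν to ℝ≥0 using h with a ha
    cases ∫⁻ y, (-φ y).toENNReal ∂ν with
    | top => simp
    | coe b => exact EReal.coe_lt_top ((a : ℝ) - b)

theorem ae_ne_zero_of_lintegral_neg_elog_ne_top {h : Y → ℝ≥0} (hm : Measurable h)
    (hN : ∫⁻ y, (-elog (h y)).toENNReal ∂ν ≠ ⊤) : ∀ᵐ y ∂ν, h y ≠ 0 := by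
  filter_upwards [ae_lt_top (measurable_elog.comp hm).neg.ereal_toENNReal hN] with y hy h0
  simp [h0, elog_zero] at hy

theorem integrable_log_of_lintegral_ne_top {h : Y → ℝ≥0} (hm : Measurable h)
    (hP : ∫⁻ y, (elog (h y)).toENNReal ∂ν ≠ ⊤) (hN : ∫⁻ y, (-elog (h y)).toENNReal ∂ν ≠ ⊤) :
    Integrable (fun y => Real.log (h y)) ν := by
  refine ⟨(Real.measurable_log.comp hm.coe_nnreal_real).aestronglyMeasurable, ?_⟩
  rw [HasFiniteIntegral]
  calc ∫⁻ y, ‖Real.log (h y)‖ₑ ∂ν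
      ≤ ∫⁻ y, ((elog (h y)).toENNReal + (-elog (h y)).toENNReal) ∂ν := by
        refine lintegral_mono_ae ?_
        filter_upwards [ae_ne_zero_of_lintegral_neg_elog_ne_top hm hN] with y hy
        rw [elog_toENNReal, neg_elog_toENNReal hy, ← ofReal_norm, Real.norm_eq_abs]
        rcases abs_cases (Real.log (h y)) with h1 | h1 <;> rw [h1.1]
        · exact le_self_add
        · exact le_add_self
    _ = _ := lintegral_add_left (measurable_elog.comp hm).ereal_toENNReal _
    _ < ⊤ := ENNReal.add_lt_top.2 ⟨hP.lt_top, hN.lt_top⟩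

theorem extIntegral_elog_eq_integral {h : Y → ℝ≥0} (h0 : ∀ᵐ y ∂ν, h y ≠ 0)
    (hi : Integrable (fun y => Real.log (h y)) ν) :
    extIntegral ν (fun y => elog (h y)) = (∫ y, Real.log (h y) ∂ν : ℝ) := by
  have hN : ∫⁻ y, (-elog (h y)).toENNReal ∂ν = ∫⁻ y, ENNReal.ofReal (-Real.log (h y)) ∂ν := by
    refine lintegral_congr_ae ?_
    filter_upwards [h0] with y hy
    exact neg_elog_toENNReal hy
  have h1 := hi.lintegral_lt_top.ne
  have h2 := hi.neg.lintegral_lt_top.ne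
  simp only [Pi.neg_apply] at h2
  rw [integral_eq_lintegral_pos_part_sub_lintegral_neg_part hi, extIntegral, hN]
  simp only [elog_toENNReal]
  rw [EReal.coe_sub, EReal.coe_ennreal_toReal h1, EReal.coe_ennreal_toReal h2]

/-- No condition on the positive part is needed, since `⊤ - ⊤ = ⊥` in `EReal`. -/
theorem exp_extIntegral_elog_eq_zero {h : Y → ℝ≥0}
    (hN : ∫⁻ y, (-elog (h y)).toENNReal ∂ν = ⊤) :
    EReal.exp (extIntegral ν (fun y => elog (h y))) = 0 := by
  simp [extIntegral, hN]

theorem lintegral_elog_mul_ne_top {h₁ h₂ : Y → ℝ≥0} (hm₁ : Measurable h₁)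
    (hP₁ : ∫⁻ y, (elog (h₁ y)).toENNReal ∂ν ≠ ⊤) (hP₂ : ∫⁻ y, (elog (h₂ y)).toENNReal ∂ν ≠ ⊤) :
    ∫⁻ y, (elog (h₁ y * h₂ y)).toENNReal ∂ν ≠ ⊤ := by
  have hle : ∀ y, (elog (h₁ y * h₂ y)).toENNReal ≤
      (elog (h₁ y)).toENNReal + (elog (h₂ y)).toENNReal := fun y => by
    rw [elog_mul]
    exact EReal.toENNReal_add_le
  refine ne_top_of_le_ne_top ?_ (lintegral_mono hle)
  rw [lintegral_add_left (show Measurable fun y => (elog (h₁ y)).toENNReal from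
    (measurable_elog.comp hm₁).ereal_toENNReal)]
  exact ENNReal.add_ne_top.2 ⟨hP₁, hP₂⟩

theorem exp_extIntegral_elog_mul_le {h₁ h₂ : Y → ℝ≥0} (hm₁ : Measurable h₁) (hm₂ : Measurable h₂)
    (hP₁ : ∫⁻ y, (elog (h₁ y)).toENNReal ∂ν ≠ ⊤) (hP₂ : ∫⁻ y, (elog (h₂ y)).toENNReal ∂ν ≠ ⊤) :
    EReal.exp (extIntegral ν (fun y => elog (h₁ y))) *
      EReal.exp (extIntegral ν (fun y => elog (h₂ y))) ≤
      EReal.exp (extIntegral ν (fun y => elog (h₁ y * h₂ y))) := by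
  by_cases hN₁ : ∫⁻ y, (-elog (h₁ y)).toENNReal ∂ν = ⊤
  · simp [exp_extIntegral_elog_eq_zero hN₁]
  by_cases hN₂ : ∫⁻ y, (-elog (h₂ y)).toENNReal ∂ν = ⊤
  · simp [exp_extIntegral_elog_eq_zero hN₂]
  have z₁ := ae_ne_zero_of_lintegral_neg_elog_ne_top hm₁ hN₁
  have z₂ := ae_ne_zero_of_lintegral_neg_elog_ne_top hm₂ hN₂
  have i₁ := integrable_log_of_lintegral_ne_top hm₁ hP₁ hN₁
  have i₂ := integrable_log_of_lintegral_ne_top hm₂ hP₂ hN₂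
  have hlog : (fun y => Real.log (h₁ y) + Real.log (h₂ y)) =ᵐ[ν]
      fun y => Real.log ((h₁ y * h₂ y : ℝ≥0) : ℝ) := by
    filter_upwards [z₁, z₂] with y hy₁ hy₂
    rw [NNReal.coe_mul, Real.log_mul (by exact_mod_cast hy₁) (by exact_mod_cast hy₂)]
  have z : ∀ᵐ y ∂ν, h₁ y * h₂ y ≠ 0 := by
    filter_upwards [z₁, z₂] with y hy₁ hy₂ using mul_ne_zero hy₁ hy₂
  rw [extIntegral_elog_eq_integral z₁ i₁, extIntegral_elog_eq_integral z₂ i₂,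
    extIntegral_elog_eq_integral z ((i₁.add i₂).congr hlog), ← EReal.exp_add, ← EReal.coe_add,
    ← integral_add i₁ i₂, integral_congr_ae hlog]

/-- Jensen's inequality: the geometric mean is at most the arithmetic mean. -/
theorem exp_extIntegral_elog_le_lintegral [IsProbabilityMeasure ν] {h : Y → ℝ≥0}
    (hm : Measurable h) (hP : ∫⁻ y, (elog (h y)).toENNReal ∂ν ≠ ⊤) :
    EReal.exp (extIntegral ν (fun y => elog (h y))) ≤ ∫⁻ y, (h y : ℝ≥0∞) ∂ν := by
  by_cases hN : ∫⁻ y, (-elog (h y)).toENNReal ∂ν = ⊤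
  · simp [exp_extIntegral_elog_eq_zero hN]
  by_cases hA : ∫⁻ y, (h y : ℝ≥0∞) ∂ν = ⊤
  · simp [hA]
  have z := ae_ne_zero_of_lintegral_neg_elog_ne_top hm hN
  have i := integrable_log_of_lintegral_ne_top hm hP hN
  have hexp : (fun y => Real.exp (Real.log (h y))) =ᵐ[ν] fun y => (h y : ℝ) := by
    filter_upwards [z] with y hy
    exact Real.exp_log (by positivity)
  have ih : Integrable (fun y => (h y : ℝ)) ν := by
    refine ⟨hm.coe_nnreal_real.aestronglyMeasurable, ?_⟩
    simpa [HasFiniteIntegral] using Ne.lt_top hA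
  have hJ := convexOn_exp.map_integral_le Real.continuous_exp.continuousOn isClosed_univ
    (Eventually.of_forall fun _ => Set.mem_univ _) i (ih.congr hexp.symm)
  rw [extIntegral_elog_eq_integral z i, EReal.exp_coe]
  refine (ENNReal.ofReal_le_ofReal (hJ.trans_eq (integral_congr_ae hexp))).trans_eq ?_
  rw [ofReal_integral_eq_lintegral_ofReal ih (Eventually.of_forall fun y => (h y).2)]
  simp

/-- A lower bound on the integrals of all truncated logarithms passes to the limit. -/
theorem le_exp_extIntegral_elog [IsProbabilityMeasure ν] {h : Y → ℝ≥0} (hm : Measurable h)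
    (hP : ∫⁻ y, (elog (h y)).toENNReal ∂ν ≠ ⊤) {c : ℝ}
    (hc : ∀ k : ℕ, c ≤ ∫ y, Real.log (max (h y : ℝ) (Real.exp (-k))) ∂ν)
    (hi : ∀ k : ℕ, Integrable (fun y => Real.log (max (h y : ℝ) (Real.exp (-k)))) ν) :
    ENNReal.ofReal (Real.exp c) ≤ EReal.exp (extIntegral ν (fun y => elog (h y))) := by
  set u : ℕ → Y → ℝ := fun k y => Real.log (max (h y : ℝ) (Real.exp (-k))) with hu
  have hum : ∀ k, Measurable (u k) := fun k =>
    Real.measurable_log.comp (hm.coe_nnreal_real.max measurable_const)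
  -- The cutoff `e^{-k}` is at most `1`, so truncation leaves the positive part unchanged.
  have hupos : ∀ k y, ENNReal.ofReal (u k y) = (elog (h y)).toENNReal := by
    intro k y
    rw [elog_toENNReal]
    rcases le_total (h y : ℝ) (Real.exp (-k)) with h1 | h1
    · have h2 : Real.log (h y) ≤ 0 := Real.log_nonpos (h y).2
        (h1.trans (Real.exp_le_one_iff.2 (by simp)))
      rw [ENNReal.ofReal_of_nonpos h2]
      simp [hu, max_eq_right h1]
    · simp [hu, max_eq_left h1]
  have hneg : ∀ y, (-elog (h y)).toENNReal ≤ ⨆ k, ENNReal.ofReal (-u k y) := by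
    intro y
    by_cases h0 : h y = 0
    · have : ∀ k : ℕ, ENNReal.ofReal (-u k y) = k := by
        intro k
        simp [hu, h0, max_eq_right (Real.exp_pos (-(k : ℝ))).le]
      simp [this, ENNReal.iSup_natCast]
    · rw [neg_elog_toENNReal h0]
      have hpos : (0 : ℝ) < h y := by positivity
      obtain ⟨k, hk⟩ := exists_nat_ge (-Real.log (h y))
      refine le_iSup_of_le k (ENNReal.ofReal_le_ofReal ?_)
      have : Real.exp (-k) ≤ h y := by
        rw [← Real.le_log_iff_exp_le hpos]
        linarith
      simp [hu, max_eq_left this]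
  have hmono : Monotone fun k y => ENNReal.ofReal (-u k y) := by
    intro j k hjk y
    refine ENNReal.ofReal_le_ofReal (neg_le_neg ?_)
    refine Real.log_le_log (lt_max_of_lt_right (Real.exp_pos _)) ?_
    gcongr
  have hN : ∫⁻ y, (-elog (h y)).toENNReal ∂ν ≤
      ENNReal.ofReal ((∫⁻ y, (elog (h y)).toENNReal ∂ν).toReal - c) := by
    refine (lintegral_mono hneg).trans ?_
    rw [lintegral_iSup (f := fun k y => ENNReal.ofReal (-u k y))
      (fun k => (hum k).neg.ennreal_ofReal) hmono]
    refine iSup_le fun k => ?_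
    have h1 := hc k
    have h2 := (hi k).neg.lintegral_lt_top.ne
    simp only [Pi.neg_apply] at h2
    rw [integral_eq_lintegral_pos_part_sub_lintegral_neg_part (hi k)] at h1
    change c ≤ (∫⁻ y, ENNReal.ofReal (u k y) ∂ν).toReal -
      (∫⁻ y, ENNReal.ofReal (-u k y) ∂ν).toReal at h1
    simp only [hupos] at h1
    rw [← ENNReal.ofReal_toReal h2]
    exact ENNReal.ofReal_le_ofReal (by change (∫⁻ y, ENNReal.ofReal (-u k y) ∂ν).toReal ≤ _; linarith)
  -- Ensures that `ENNReal.ofReal` in `hN` does not clip a negative number.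
  have hPc : c ≤ (∫⁻ y, (elog (h y)).toENNReal ∂ν).toReal := by
    have h1 := hc 0
    rw [integral_eq_lintegral_pos_part_sub_lintegral_neg_part (hi 0)] at h1
    change c ≤ (∫⁻ y, ENNReal.ofReal (u 0 y) ∂ν).toReal -
      (∫⁻ y, ENNReal.ofReal (-u 0 y) ∂ν).toReal at h1
    simp only [hupos] at h1
    exact h1.trans (sub_le_self _ ENNReal.toReal_nonneg)
  have hN' := ne_top_of_le_ne_top ENNReal.ofReal_ne_top hN
  rw [← EReal.exp_coe, EReal.exp_le_exp_iff, extIntegral, ← EReal.coe_ennreal_toReal hP,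
    ← EReal.coe_ennreal_toReal hN', ← EReal.coe_sub, EReal.coe_le_coe_iff]
  have := ENNReal.toReal_le_of_le_ofReal (by linarith) hN
  linarith

/-! ### The implications -/

variable {X : Type*} {f : X → ℝ≥0} {g : X → Y → ℝ≥0}

theorem measurable_tensorPow (hg : ∀ x, Measurable (g x)) {n : ℕ} (x : Fin n → X) :
    Measurable fun y => tensorPow (fun z => g z y) n x :=
  Finset.measurable_prod _ fun j _ => hg (x j)

theorem tensorPow_succ (f : X → ℝ≥0) (n : ℕ) (x : Fin (n + 1) → X) :
    tensorPow f (n + 1) x = f (x 0) * tensorPow f n (Fin.tail x) :=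
  Fin.prod_univ_succ _

theorem lintegral_elog_tensorPow_ne_top (hg : ∀ x, Measurable (g x))
    (hP : ∀ x, ∫⁻ y, (elog (g x y)).toENNReal ∂ν ≠ ⊤) (n : ℕ) (x : Fin n → X) :
    ∫⁻ y, (elog (tensorPow (fun z => g z y) n x)).toENNReal ∂ν ≠ ⊤ := by
  induction n with
  | zero => simp [tensorPow, elog]
  | succ n ih =>
    simp only [tensorPow_succ]
    exact lintegral_elog_mul_ne_top (hg _) (hP _) (ih _)

theorem tensorPow_le_exp_extIntegral_elog (hg : ∀ x, Measurable (g x))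
    (hP : ∀ x, ∫⁻ y, (elog (g x y)).toENNReal ∂ν ≠ ⊤)
    (hf : ∀ x, (f x : ℝ≥0∞) ≤ EReal.exp (extIntegral ν (fun y => elog (g x y))))
    (n : ℕ) (x : Fin n → X) :
    (tensorPow f n x : ℝ≥0∞) ≤
      EReal.exp (extIntegral ν (fun y => elog (tensorPow (fun z => g z y) n x))) := by
  induction n with
  | zero => simp [tensorPow, elog, extIntegral]
  | succ n ih =>
    simp only [tensorPow_succ, ENNReal.coe_mul]
    exact (mul_le_mul' (hf _) (ih _)).trans (exp_extIntegral_elog_mul_le (hg _)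
      (measurable_tensorPow hg _) (hP _) (lintegral_elog_tensorPow_ne_top hg hP _ _))

theorem SingleCopyGeometric.multiCopyGeometric (hg : ∀ x, Measurable (g x))
    (h : SingleCopyGeometric f g) : MultiCopyGeometric f g := by
  obtain ⟨ν, hν, hex, hf⟩ := h
  have hP := fun x => integralExists_and_extIntegral_lt_top_iff.1 (hex x)
  exact ⟨fun _ => ν, fun _ _ => hν,
    fun n _ x => integralExists_and_extIntegral_lt_top_iff.2
      (lintegral_elog_tensorPow_ne_top hg hP n x),
    fun n _ x => tensorPow_le_exp_extIntegral_elog hg hP hf n x⟩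

theorem MultiCopyGeometric.singleCopyGeometric (h : MultiCopyGeometric f g) :
    SingleCopyGeometric f g := by
  obtain ⟨ν, hν, hex, hf⟩ := h
  refine ⟨ν 1, hν 1 le_rfl, fun x => ?_, fun x => ?_⟩
  · simpa [tensorPow] using hex 1 le_rfl fun _ => x
  · simpa [tensorPow] using hf 1 le_rfl fun _ => x

theorem SingleCopyGeometric.multiCopyArithmetic (hg : ∀ x, Measurable (g x))
    (h : SingleCopyGeometric f g) : MultiCopyArithmetic f g := by
  obtain ⟨ν, hν, hex, hf⟩ := h
  have hP := fun x => integralExists_and_extIntegral_lt_top_iff.1 (hex x)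
  exact ⟨ν, hν, fun n _ x => (tensorPow_le_exp_extIntegral_elog hg hP hf n x).trans
    (exp_extIntegral_elog_le_lintegral (measurable_tensorPow hg x)
      (lintegral_elog_tensorPow_ne_top hg hP n x))⟩

theorem MultiCopyArithmetic.multiCopyArithmeticSeq (h : MultiCopyArithmetic f g) :
    MultiCopyArithmeticSeq f g := by
  obtain ⟨μ, hμ, hf⟩ := h
  exact ⟨fun _ => μ, by simp, hf⟩

/-! ### From arithmetic means back to a geometric mean on a compact space -/

/-- Such growth would keep the quotient at least `1 / n` along the multiples of `n`. -/
theorem not_forall_exp_le_of_limsup_log_div_le_zero {a : ℕ → ℝ≥0∞}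
    (ha : limsup (fun n : ℕ => ENNReal.log (a n) / (n : EReal)) atTop ≤ 0) {n : ℕ} (hn : n ≠ 0) :
    ¬ ∀ k : ℕ, k ≠ 0 → ENNReal.ofReal (Real.exp k) ≤ a (k * n) := by
  intro h
  have hn' : (0 : ℝ) < n := by positivity
  have hlt : limsup (fun n : ℕ => ENNReal.log (a n) / (n : EReal)) atTop < ((1 / n : ℝ) : EReal) :=
    ha.trans_lt (by exact_mod_cast (by positivity : (0 : ℝ) < 1 / n))
  obtain ⟨m, hm⟩ := eventually_atTop.1 (eventually_lt_of_limsup_lt hlt)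
  have h1 := hm ((m + 1) * n) (by nlinarith [Nat.pos_of_ne_zero hn])
  refine absurd h1 (not_lt.2 ?_)
  have h2 : ((m + 1 : ℕ) : EReal) ≤ ENNReal.log (a ((m + 1) * n)) := by
    have := ENNReal.log_monotone (h (m + 1) m.succ_ne_zero)
    rwa [ENNReal.log_ofReal_of_pos (Real.exp_pos _), Real.log_exp] at this
  refine le_trans (le_of_eq ?_) (EReal.div_le_div_right_of_nonneg (Nat.cast_nonneg' _) h2)
  have h3 : (1 / n : ℝ) = ((m + 1 : ℕ) : ℝ) / (((m + 1) * n : ℕ) : ℝ) := by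
    push_cast
    field_simp
  rw [h3, EReal.coe_div]
  rfl

theorem tensorPow_get (f : X → ℝ≥0) (l : List X) :
    tensorPow f l.length l.get = (l.map f).prod := by
  simp [tensorPow, Fin.prod_univ_fun_getElem]

theorem prod_map_flatten_replicate (f : X → ℝ≥0) (k : ℕ) (l : List X) :
    ((List.replicate k l).flatten.map f).prod = (l.map f).prod ^ k := by
  simp [List.map_flatten, List.prod_flatten]

/-- The logarithm of `h`, truncated from below at `-k`, shifted by `c`. -/
noncomputable def truncLog {Z : Type*} [TopologicalSpace Z] (h : C(Z, ℝ≥0)) (c : ℝ) (k : ℕ) :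
    C(Z, ℝ) where
  toFun y := Real.log (max (h y : ℝ) (Real.exp (-k))) - c
  continuous_toFun := by
    refine Continuous.sub (Continuous.log (by fun_prop) fun y => ?_) continuous_const
    exact (lt_max_of_lt_right (Real.exp_pos _)).ne'

/-- Sums of logarithms exponentiate to products, and truncation from below only enlarges `g`. Lists
make concatenation and repetition of tuples painless. -/
theorem exists_list_prod_le {Z : Type*} [TopologicalSpace Z] {g : X → C(Z, ℝ≥0)} {h : C(Z, ℝ)}
    (hh : h ∈ AddSubmonoid.closure {φ | ∃ x k, f x ≠ 0 ∧ φ = truncLog (g x) (Real.log (f x)) k}) :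
    ∃ l : List X, (l.map f).prod ≠ 0 ∧
      ∀ y, (l.map fun x => g x y).prod ≤ (Real.exp (h y)).toNNReal * (l.map f).prod := by
  induction hh using AddSubmonoid.closure_induction with
  | mem φ hφ =>
    obtain ⟨x, k, hx, rfl⟩ := hφ
    refine ⟨[x], by simpa using hx, fun y => ?_⟩
    have hfx : (0 : ℝ) < f x := by positivity
    rw [← NNReal.coe_le_coe]
    simp only [List.map_cons, List.map_nil, List.prod_cons, List.prod_nil, mul_one, NNReal.coe_mul,
      Real.coe_toNNReal _ (Real.exp_pos _).le, truncLog, ContinuousMap.coe_mk]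
    rw [Real.exp_sub, Real.exp_log (lt_max_of_lt_right (Real.exp_pos _)), Real.exp_log hfx,
      div_mul_cancel₀ _ hfx.ne']
    exact le_max_left _ _
  | zero => exact ⟨[], by simp, fun y => by simp⟩
  | add a b _ _ ha hb =>
    obtain ⟨l, hl, hl'⟩ := ha
    obtain ⟨m, hm, hm'⟩ := hb
    refine ⟨l ++ m, by simpa only [List.map_append, List.prod_append] using mul_ne_zero hl hm, fun y => ?_⟩
    simp only [List.map_append, List.prod_append, ContinuousMap.add_apply, Real.exp_add,
      Real.toNNReal_mul (Real.exp_pos _).le]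
    rw [mul_mul_mul_comm]
    exact mul_le_mul' (hl' y) (hm' y)

theorem MultiCopyArithmeticSeq.singleCopyGeometric [Nonempty Y] [TopologicalSpace Y]
    [CompactSpace Y] [T2Space Y] [BorelSpace Y]
    (hg : ∀ x, Continuous (g x)) (h : MultiCopyArithmeticSeq f g) : SingleCopyGeometric f g := by
  obtain ⟨μ, hμ, hf⟩ := h
  set G : X → C(Y, ℝ≥0) := fun x => ⟨g x, hg x⟩ with hG
  obtain ⟨L, hLpos, hL1, hLS⟩ := exists_positive_functional_nonneg
    (S := {φ | ∃ x k, f x ≠ 0 ∧ φ = truncLog (G x) (Real.log (f x)) k}) (by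
      intro φ hφ hle
      obtain ⟨l, hl0, hl⟩ := exists_list_prod_le hφ
      -- The empty list would give `1 ≤ exp (φ y)`, impossible when `φ y ≤ -1`.
      have hn : l.length ≠ 0 := by
        intro h0
        obtain rfl := List.length_eq_zero_iff.1 h0
        obtain ⟨y⟩ := ‹Nonempty Y›
        have h1 := hl y
        have h2 := hle y
        simp only [List.map_nil, List.prod_nil, mul_one, Real.one_le_toNNReal] at h1
        rw [Real.one_le_exp_iff] at h1
        linarith
      refine not_forall_exp_le_of_limsup_log_div_le_zero hμ hn fun k hk => ?_
      have hlen : (List.replicate k l).flatten.length = k * l.length := by simp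
      have h1 := hf _ (Nat.one_le_iff_ne_zero.2 (hlen ▸ mul_ne_zero hk hn))
        (List.replicate k l).flatten.get
      simp only [tensorPow_get, prod_map_flatten_replicate] at h1
      rw [hlen] at h1
      set F := (l.map f).prod with hF
      set c := (Real.exp (-1)).toNNReal with hc
      have hbound : ∀ y, (l.map fun x => g x y).prod ≤ c * F := fun y => (hl y).trans
        (mul_le_mul_left (Real.toNNReal_le_toNNReal (Real.exp_le_exp.2 (hle y))) F)
      -- Cancelling `F ^ k` here leaves mass at least `c ^ (-k) = e^k`.
      have h2 : ((F ^ k : ℝ≥0) : ℝ≥0∞) ≤ (((c * F) ^ k : ℝ≥0) : ℝ≥0∞) * μ (k * l.length) Set.univ := by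
        rw [← lintegral_const]
        exact h1.trans (lintegral_mono fun y => ENNReal.coe_le_coe.2
          (pow_le_pow_left₀ zero_le (hbound y) k))
      have hFk : ((F ^ k : ℝ≥0) : ℝ≥0∞) ≠ 0 := by simpa using fun h => absurd h hl0
      have h3 : 1 ≤ ((c ^ k : ℝ≥0) : ℝ≥0∞) * μ (k * l.length) Set.univ := by
        rw [mul_pow, ENNReal.coe_mul, mul_comm ((c ^ k : ℝ≥0) : ℝ≥0∞), mul_assoc] at h2
        exact (ENNReal.mul_le_mul_iff_right hFk ENNReal.coe_ne_top).1 (by rwa [mul_one])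
      have h4 : ENNReal.ofReal (Real.exp k) * ((c ^ k : ℝ≥0) : ℝ≥0∞) = 1 := by
        rw [hc, ← Real.toNNReal_pow (Real.exp_pos _).le, ← Real.exp_nat_mul]
        change ENNReal.ofReal _ * ENNReal.ofReal _ = 1
        rw [← ENNReal.ofReal_mul (Real.exp_pos _).le, ← Real.exp_add]
        simp
      calc ENNReal.ofReal (Real.exp k) = ENNReal.ofReal (Real.exp k) * 1 := (mul_one _).symm
        _ ≤ ENNReal.ofReal (Real.exp k) *
            (((c ^ k : ℝ≥0) : ℝ≥0∞) * μ (k * l.length) Set.univ) := by gcongr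
        _ = μ (k * l.length) Set.univ := by rw [← mul_assoc, h4, one_mul])
  obtain ⟨ν, hν, hνL⟩ := exists_isProbabilityMeasure_integral_eq L hLpos hL1
  -- By compactness `g x` is bounded above.
  have hP : ∀ x, ∫⁻ y, (elog (g x y)).toENNReal ∂ν ≠ ⊤ := by
    intro x
    obtain ⟨y₀, -, hy₀⟩ := isCompact_univ.exists_isMaxOn Set.univ_nonempty (hg x).continuousOn
    refine ne_top_of_le_ne_top ?_ (lintegral_mono (g := fun _ => (elog (g x y₀)).toENNReal)
      fun y => EReal.toENNReal_le_toENNReal (ENNReal.log_monotone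
        (ENNReal.coe_le_coe.2 (hy₀ (Set.mem_univ y)))))
    simp [elog_toENNReal]
  refine ⟨ν, hν, fun x => integralExists_and_extIntegral_lt_top_iff.2 (hP x), fun x => ?_⟩
  rcases eq_or_ne (f x) 0 with hx | hx
  · simp [hx]
  have hi : ∀ k : ℕ, Integrable (fun y => Real.log (max (g x y : ℝ) (Real.exp (-k)))) ν := by
    intro k
    have := (truncLog (G x) 0 k).continuous.integrable_of_hasCompactSupport (μ := ν)
      (HasCompactSupport.of_compactSpace _)
    simpa [truncLog, hG] using this
  have hlow : ∀ k : ℕ, Real.log (f x) ≤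
      ∫ y, Real.log (max (g x y : ℝ) (Real.exp (-k))) ∂ν := by
    intro k
    have h1 := hLS _ ⟨x, k, hx, rfl⟩
    rw [← hνL] at h1
    change 0 ≤ ∫ y, (Real.log (max (g x y : ℝ) (Real.exp (-k))) - Real.log (f x)) ∂ν at h1
    rw [integral_sub (hi k) (integrable_const _)] at h1
    simpa using h1
  have := le_exp_extIntegral_elog (hg x).measurable (hP x) hlow hi
  rwa [Real.exp_log (by positivity), ENNReal.ofReal_coe_nnreal] at this

end MeanBounds

theorem mainTheorem7 {X Y : Type*} [Nonempty X] [Nonempty Y] [MeasurableSpace Y]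
    (f : X → ℝ≥0) (g : X → Y → ℝ≥0) (hg : ∀ x : X, Measurable (g x)) :
    (MeanBounds.SingleCopyGeometric f g ↔ MeanBounds.MultiCopyGeometric f g) ∧
    (MeanBounds.MultiCopyGeometric f g → MeanBounds.MultiCopyArithmetic f g) ∧
    (MeanBounds.MultiCopyArithmetic f g → MeanBounds.MultiCopyArithmeticSeq f g) ∧
    (∀ [TopologicalSpace Y] [CompactSpace Y] [T2Space Y] [BorelSpace Y],
      (∀ x : X, Continuous (g x)) →
        MeanBounds.MultiCopyArithmeticSeq f g → MeanBounds.SingleCopyGeometric f g) :=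
  ⟨⟨fun h => h.multiCopyGeometric hg, fun h => h.singleCopyGeometric⟩,
    fun h => h.singleCopyGeometric.multiCopyArithmetic hg,
    fun h => h.multiCopyArithmeticSeq,
    fun hc h => h.singleCopyGeometric hc⟩
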